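/- Let $p,s\ge 0$ be integers, let $\theta>0$, $A_i>0$, $\alpha_i>0$, $a_i\ge 0$ for $1\le i\le p$ and $B_j>0$, $\beta_j>0$, $b_j\ge 0$ for $1\le j\le s$ be real numbers, and set, for $x>0$ and $u>0$ (empty sums being $0$ and empty products $1$), $$V(x)=\theta^{-x}\,\frac{\prod_{i=1}^{p}\Gamma(A_i x+a_i)^{\alpha_i}}{\prod_{j=1}^{s}\Gamma(B_j x+b_j)^{\beta_j}},\qquad Q(u)=\sum_{i=1}^{p}\frac{\alpha_i e^{-a_iu/A_i}}{1-e^{-u/A_i}}-\sum_{j=1}^{s}\frac{\beta_j e^{-b_ju/B_j}}{1-e^{-u/B_j}},\qquad \rho=\prod_{i=1}^{p}A_i^{\alpha_iA_i}\prod_{j=1}^{s}B_j^{-\beta_jB_j}.$$ A function $f$ is completely monotonic on $(0,\infty)$ if it is infinitely differentiable there and $(-1)^n f^{(n)}(x)\ge 0$ for all $n\ge 0$ and $x>0$. A positive, infinitely differentiable function $f$ on $(0,\infty)$ is logarithmically completely monotonic if $(-\log f)'$ is completely monotonic on $(0,\infty)$. Then $V$ is logarithmically completely monotonic on $(0,\infty)$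 if and only if all three of the following conditions hold: 1. $Q(u)\ge 0$ for all $u>0$; 2. $\sum_{i=1}^{p}\alpha_iA_i=\sum_{j=1}^{s}\beta_jB_j$; 3. $\rho\le\theta$. Moreover, if $V$ is logarithmically completely monotonic, then for every $x>0$ $$(-\log V(x))'=\int_0^\infty e^{-xu}Q(u)\,du+\log(\theta/\rho),$$ where the integral converges absolutely. -/

import Mathlib

open scoped ContDiff

/-- Completely monotonic functions on `(0, ∞)`; the case `n = 0` says that `f` is non-negative. -/
structure IsCompletelyMonotonic (f : ℝ → ℝ) : Prop where
  smooth : ContDiffOn ℝ ∞ f (Set.Ioi 0)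
  sign : ∀ (n : ℕ) (x : ℝ), 0 < x → 0 ≤ (-1 : ℝ) ^ n * iteratedDeriv n f x

/-- Logarithmically completely monotonic functions on `(0, ∞)`. -/
structure IsLogCompletelyMonotonic (f : ℝ → ℝ) : Prop where
  pos : ∀ x : ℝ, 0 < x → 0 < f x
  smooth : ContDiffOn ℝ ∞ f (Set.Ioi 0)
  neg_log_deriv : IsCompletelyMonotonic (deriv fun x : ℝ => -Real.log (f x))

/-- `V(x) = θ ^ (-x) * ∏ Γ(A i * x + a i) ^ α i / ∏ Γ(B j * x + b j) ^ β j`. -/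
noncomputable def gammaRatio {p s : ℕ} (θ : ℝ) (A a α : Fin p → ℝ) (B b β : Fin s → ℝ)
    (x : ℝ) : ℝ :=
  θ ^ (-x) * ((∏ i, Real.Gamma (A i * x + a i) ^ α i) / ∏ j, Real.Gamma (B j * x + b j) ^ β j)

/-- `Q(u) = ∑ α i e^{-a i u / A i} / (1 - e^{-u / A i}) - ∑ β j e^{-b j u / B j} / (1 - e^{-u / B j})`. -/
noncomputable def gammaRatioQ {p s : ℕ} (A a α : Fin p → ℝ) (B b β : Fin s → ℝ) (u : ℝ) : ℝ :=
  ∑ i, α i * Real.exp (-(a i * u / A i)) / (1 - Real.exp (-(u / A i))) -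
    ∑ j, β j * Real.exp (-(b j * u / B j)) / (1 - Real.exp (-(u / B j)))

/-- `ρ = ∏ A i ^ (α i * A i) * ∏ B j ^ (-(β j * B j))`. -/
noncomputable def gammaRatioRho {p s : ℕ} (A α : Fin p → ℝ) (B β : Fin s → ℝ) : ℝ :=
  (∏ i, A i ^ (α i * A i)) * ∏ j, B j ^ (-(β j * B j))

/-!
Write `ψ = Γ' / Γ`. The negative logarithmic derivative of the gamma ratio is
`log θ - ∑ α i A i ψ(A i x + a i) + ∑ β j B j ψ(B j x + b j)`. Gauss's integral with a shift
(`logDeriv_Gamma_add_eq`),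
`ψ(y + a) = log y - ∫₀^∞ e^{-yt} (e^{-at} / (1 - e^{-t}) - 1 / t) dt`,
turns it into `log (θ / ρ) - κ log x + ∫₀^∞ e^{-xu} R(u) du`, where `κ = ∑ α i A i - ∑ β j B j` and
`R(u) = Q(u) - κ / u` is bounded and continuous on `(0, ∞)` (`hasDerivAt_neg_log_gammaRatio`).

Such a function is completely monotonic exactly when `R ≥ 0`, `κ = 0` and `log (θ / ρ) ≥ 0`
(`isCompletelyMonotonic_iff_of_eq_laplaceMoment`). Sufficiency is differentiation under the integral.
Conversely, a completely monotonic function is non-negative and decreasing, hence bounded at infinity,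
which forces `κ = 0`; its limit at infinity is then `log (θ / ρ)`, which must be non-negative. Finally
the derivatives of order `n ≥ 1` are, up to sign, the integrals `∫₀^∞ uⁿ e^{-xu} R(u) du`, and for
`x = n / u₀` the weight `uⁿ e^{-xu}` concentrates at `u₀` as `n → ∞`, so `R(u₀) ≥ 0`
(`nonneg_of_laplaceMoment_nonneg`). As `R = Q` when `κ = 0`, Bernstein's representation theorem is not
needed.
-/

open MeasureTheory Set Filter Topology

/-! ### Laplace transforms of bounded continuous functions -/

/-- The weighted Laplace integral `∫₀^∞ uⁿ e^{-xu} q(u) du`; up to the sign `(-1)ⁿ` it is the `n`-th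
derivative of the Laplace transform of `q`. -/
noncomputable def laplaceMoment (q : ℝ → ℝ) (n : ℕ) (x : ℝ) : ℝ :=
  ∫ u in Ioi (0 : ℝ), u ^ n * Real.exp (-(x * u)) * q u

lemma integrableOn_pow_mul_exp_neg_mul (n : ℕ) {x : ℝ} (hx : 0 < x) :
    IntegrableOn (fun u : ℝ => u ^ n * Real.exp (-(x * u))) (Ioi 0) := by
  have h := integrableOn_rpow_mul_exp_neg_mul_rpow (p := 1) (s := n) (b := x)
    (by linarith [n.cast_nonneg (α := ℝ)]) one_pos hx
  refine h.congr_fun (fun u _ => ?_) measurableSet_Ioi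
  simp

lemma integral_pow_mul_exp_neg_mul (n : ℕ) {x : ℝ} (hx : 0 < x) :
    ∫ u in Ioi (0 : ℝ), u ^ n * Real.exp (-(x * u)) = n.factorial / x ^ (n + 1) := by
  have h := Real.integral_rpow_mul_exp_neg_mul_Ioi (a := n + 1) (r := x) (by positivity) hx
  rw [Real.Gamma_nat_eq_factorial] at h
  have h1 : (1 / x) ^ ((n : ℝ) + 1) = 1 / x ^ (n + 1) := by
    rw [← Nat.cast_succ, Real.rpow_natCast, div_pow, one_pow]
  rw [h1] at h
  simp only [add_sub_cancel_right, Real.rpow_natCast] at h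
  rw [h]; ring

lemma integrableOn_laplaceMoment {q : ℝ → ℝ} {M : ℝ} (hq : ContinuousOn q (Ioi 0))
    (hM : ∀ u, 0 < u → |q u| ≤ M) (n : ℕ) {x : ℝ} (hx : 0 < x) :
    IntegrableOn (fun u : ℝ => u ^ n * Real.exp (-(x * u)) * q u) (Ioi 0) := by
  refine Integrable.mul_bdd (c := M) (integrableOn_pow_mul_exp_neg_mul n hx)
    (hq.aestronglyMeasurable measurableSet_Ioi) ?_
  filter_upwards [ae_restrict_mem measurableSet_Ioi] with u hu using hM u hu

lemma abs_laplaceMoment_le {q : ℝ → ℝ} {M : ℝ} (hM : ∀ u, 0 < u → |q u| ≤ M) (n : ℕ) {x : ℝ}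
    (hx : 0 < x) : |laplaceMoment q n x| ≤ n.factorial / x ^ (n + 1) * M := by
  rw [← integral_pow_mul_exp_neg_mul n hx, ← integral_mul_const, ← Real.norm_eq_abs]
  refine norm_integral_le_of_norm_le ((integrableOn_pow_mul_exp_neg_mul n hx).mul_const M) ?_
  filter_upwards [ae_restrict_mem measurableSet_Ioi] with u hu
  have hu : 0 < u := hu
  rw [Real.norm_eq_abs, abs_mul, abs_of_pos (by positivity)]
  exact mul_le_mul_of_nonneg_left (hM u hu) (by positivity)

lemma tendsto_laplaceMoment_zero {q : ℝ → ℝ} {M : ℝ} (hM : ∀ u, 0 < u → |q u| ≤ M) :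
    Tendsto (laplaceMoment q 0) atTop (𝓝 0) := by
  have h : Tendsto (fun x : ℝ => M * x⁻¹) atTop (𝓝 0) := by
    simpa using tendsto_inv_atTop_zero.const_mul M
  refine squeeze_zero_norm' ?_ h
  filter_upwards [eventually_gt_atTop 0] with x hx
  simpa [div_eq_mul_inv, mul_comm] using abs_laplaceMoment_le hM 0 hx

lemma hasDerivAt_laplaceMoment {q : ℝ → ℝ} {M : ℝ} (hq : ContinuousOn q (Ioi 0))
    (hM : ∀ u, 0 < u → |q u| ≤ M) (n : ℕ) {x : ℝ} (hx : 0 < x) :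
    HasDerivAt (laplaceMoment q n) (-laplaceMoment q (n + 1) x) x := by
  have key := hasDerivAt_integral_of_dominated_loc_of_deriv_le
    (μ := volume.restrict (Ioi (0 : ℝ)))
    (F := fun y u : ℝ => u ^ n * Real.exp (-(y * u)) * q u)
    (F' := fun y u : ℝ => -(u ^ (n + 1) * Real.exp (-(y * u)) * q u))
    (bound := fun u : ℝ => u ^ (n + 1) * Real.exp (-(x / 2 * u)) * M)
    (Ioi_mem_nhds (half_lt_self hx)) ?_ (integrableOn_laplaceMoment hq hM n hx)
    (integrableOn_laplaceMoment hq hM (n + 1) hx).neg.aestronglyMeasurable ?_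
    ((integrableOn_pow_mul_exp_neg_mul (n + 1) (half_pos hx)).mul_const M) ?_
  · have h := key.2
    rw [integral_neg] at h
    exact h
  · filter_upwards [Ioi_mem_nhds hx] with y hy
    exact (integrableOn_laplaceMoment hq hM n hy).aestronglyMeasurable
  · filter_upwards [ae_restrict_mem measurableSet_Ioi] with u hu y hy
    have hu : 0 < u := hu
    have hy : x / 2 < y := hy
    rw [norm_neg, Real.norm_eq_abs, abs_mul, abs_of_pos (by positivity)]
    gcongr
    exact hM u hu
  · filter_upwards with u y _
    have h : HasDerivAt (fun y : ℝ => Real.exp (-(y * u))) (Real.exp (-(y * u)) * -(1 * u)) y :=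
      ((hasDerivAt_id y).mul_const u).neg.exp
    exact ((h.const_mul (u ^ n)).mul_const (q u)).congr_deriv (by ring)

lemma contDiffOn_laplaceMoment {q : ℝ → ℝ} {M : ℝ} (hq : ContinuousOn q (Ioi 0))
    (hM : ∀ u, 0 < u → |q u| ≤ M) (n : ℕ) : ContDiffOn ℝ ∞ (laplaceMoment q n) (Ioi 0) := by
  rw [contDiffOn_infty]
  intro m
  induction m generalizing n with
  | zero =>
    exact contDiffOn_zero.2 fun x hx =>
      (hasDerivAt_laplaceMoment hq hM n hx).continuousAt.continuousWithinAt
  | succ m ih =>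
    rw [Nat.cast_succ, contDiffOn_succ_iff_deriv_of_isOpen isOpen_Ioi]
    refine ⟨fun x hx =>
      (hasDerivAt_laplaceMoment hq hM n hx).differentiableAt.differentiableWithinAt, by simp, ?_⟩
    exact (ih (n + 1)).neg.congr fun x hx => (hasDerivAt_laplaceMoment hq hM n hx).deriv

lemma iteratedDeriv_laplaceMoment {q : ℝ → ℝ} {M : ℝ} (hq : ContinuousOn q (Ioi 0))
    (hM : ∀ u, 0 < u → |q u| ≤ M) (n : ℕ) {x : ℝ} (hx : 0 < x) :
    iteratedDeriv n (laplaceMoment q 0) x = (-1) ^ n * laplaceMoment q n x := by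
  induction n generalizing x with
  | zero => simp
  | succ n ih =>
    have h : iteratedDeriv n (laplaceMoment q 0) =ᶠ[𝓝 x] fun y => (-1) ^ n * laplaceMoment q n y :=
      by
      filter_upwards [Ioi_mem_nhds hx] with y hy using ih hy
    rw [iteratedDeriv_succ, h.deriv_eq,
      ((hasDerivAt_laplaceMoment hq hM n hx).const_mul ((-1) ^ n)).deriv]
    ring

/-- Uniqueness half of Bernstein's theorem, for bounded continuous densities. If `q(u₀) < 0`, then
`q ≤ -ε + C (u - u₀)²` on `(0, ∞)` for some `ε > 0`. Integrating this majorant against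
`uⁿ e^{-nu/u₀}`, a density that concentrates at `u₀`, gives
`n! (u₀/n)ⁿ⁺¹ (-ε + C u₀² (n + 2) / n²)`, which is negative for large `n`. -/
lemma nonneg_of_laplaceMoment_nonneg {q : ℝ → ℝ} {M : ℝ} (hq : ContinuousOn q (Ioi 0))
    (hM : ∀ u, 0 < u → |q u| ≤ M)
    (h : ∀ n : ℕ, 1 ≤ n → ∀ x : ℝ, 0 < x → 0 ≤ laplaceMoment q n x) {u₀ : ℝ} (hu₀ : 0 < u₀) :
    0 ≤ q u₀ := by
  by_contra! hneg
  obtain ⟨ε, hε, hεq⟩ : ∃ ε > 0, q u₀ < -ε := ⟨-q u₀ / 2, by linarith, by linarith⟩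
  have hM0 : 0 ≤ M := (abs_nonneg _).trans (hM u₀ hu₀)
  have hev : ∀ᶠ u in 𝓝 u₀, q u < -ε :=
    (hq.continuousAt (Ioi_mem_nhds hu₀)).eventually_lt continuousAt_const hεq
  obtain ⟨δ, hδ, hδq⟩ := Metric.eventually_nhds_iff.1 hev
  set C : ℝ := (M + ε) / δ ^ 2 with hC
  have hC0 : 0 ≤ C := by positivity
  have hmaj : ∀ u, 0 < u → q u ≤ -ε + C * (u - u₀) ^ 2 := by
    intro u hu
    by_cases hd : dist u u₀ < δ
    · have := hδq hd
      have : 0 ≤ C * (u - u₀) ^ 2 := by positivity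
      linarith
    · have h1 : δ ^ 2 ≤ (u - u₀) ^ 2 := by
        rw [not_lt, Real.dist_eq] at hd
        rw [← sq_abs (u - u₀)]
        gcongr
      have h2 : C * δ ^ 2 ≤ C * (u - u₀) ^ 2 := by gcongr
      have h3 : C * δ ^ 2 = M + ε := by rw [hC]; field_simp
      linarith [le_abs_self (q u), hM u hu]
  have hlim : Tendsto (fun n : ℕ => C * u₀ ^ 2 * (((n : ℝ) + 2) / (n : ℝ) ^ 2)) atTop (𝓝 0) := by
    have h1 : Tendsto (fun n : ℕ => ((n : ℝ))⁻¹) atTop (𝓝 0) := tendsto_inv_atTop_nhds_zero_nat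
    have h2 : Tendsto (fun n : ℕ => C * u₀ ^ 2 * (((n : ℝ))⁻¹ + 2 * ((n : ℝ)⁻¹ * (n : ℝ)⁻¹)))
        atTop (𝓝 0) := by
      simpa using (h1.add ((h1.mul h1).const_mul 2)).const_mul (C * u₀ ^ 2)
    refine h2.congr' ?_
    filter_upwards [eventually_gt_atTop 0] with n hn
    have : (n : ℝ) ≠ 0 := by positivity
    field_simp
  obtain ⟨n, hn1, hn2⟩ :=
    ((eventually_ge_atTop 1).and (hlim.eventually (gt_mem_nhds hε))).exists
  have hn0 : (0 : ℝ) < n := by exact_mod_cast hn1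
  set x : ℝ := n / u₀ with hx
  have hx0 : 0 < x := by positivity
  have i0 := integrableOn_pow_mul_exp_neg_mul n hx0
  have i1 := integrableOn_pow_mul_exp_neg_mul (n + 1) hx0
  have i2 := integrableOn_pow_mul_exp_neg_mul (n + 2) hx0
  have i01 : IntegrableOn (fun u : ℝ => (C * u₀ ^ 2 - ε) * (u ^ n * Real.exp (-(x * u))) -
      2 * C * u₀ * (u ^ (n + 1) * Real.exp (-(x * u)))) (Ioi 0) :=
    (i0.const_mul _).sub (i1.const_mul _)
  have hle : laplaceMoment q n x ≤
      ∫ u in Ioi (0 : ℝ), ((C * u₀ ^ 2 - ε) * (u ^ n * Real.exp (-(x * u))) -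
        2 * C * u₀ * (u ^ (n + 1) * Real.exp (-(x * u))) +
        C * (u ^ (n + 2) * Real.exp (-(x * u)))) := by
    refine setIntegral_mono_on (integrableOn_laplaceMoment hq hM n hx0)
      (i01.add (i2.const_mul _)) measurableSet_Ioi ?_
    intro u hu
    have hu : 0 < u := hu
    have := mul_le_mul_of_nonneg_left (hmaj u hu)
      (show 0 ≤ u ^ n * Real.exp (-(x * u)) by positivity)
    refine this.trans (le_of_eq ?_)
    ring
  rw [integral_add i01 (i2.const_mul _),
    integral_sub (i0.const_mul _) (i1.const_mul _), integral_const_mul, integral_const_mul,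
    integral_const_mul, integral_pow_mul_exp_neg_mul n hx0,
    integral_pow_mul_exp_neg_mul (n + 1) hx0, integral_pow_mul_exp_neg_mul (n + 2) hx0] at hle
  have heq : (C * u₀ ^ 2 - ε) * (n.factorial / x ^ (n + 1)) -
      2 * C * u₀ * ((n + 1).factorial / x ^ (n + 1 + 1)) +
      C * ((n + 2).factorial / x ^ (n + 2 + 1)) =
      n.factorial / x ^ (n + 1) * (C * u₀ ^ 2 * (((n : ℝ) + 2) / (n : ℝ) ^ 2) - ε) := by
    have hu : u₀ = n / x := by rw [hx]; field_simp
    rw [Nat.factorial_succ (n + 1), Nat.factorial_succ n, hu]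
    push_cast
    field_simp
    ring
  rw [heq] at hle
  have := h n hn1 x hx0
  have : n.factorial / x ^ (n + 1) * (C * u₀ ^ 2 * (((n : ℝ) + 2) / (n : ℝ) ^ 2) - ε) < 0 :=
    mul_neg_of_pos_of_neg (by positivity) (by linarith)
  linarith

/-! ### Gauss's integral for the shifted digamma function -/

/-- The function `e^{-at} / (1 - e^{-t}) - 1 / t`, bounded on `(0, ∞)` for `a ≥ 0`. Its Laplace
transform at `y` is `log y - ψ(y + a)`, where `ψ = Γ' / Γ`. -/
noncomputable def digammaKernel (a t : ℝ) : ℝ :=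
  Real.exp (-(a * t)) / (1 - Real.exp (-t)) - 1 / t

lemma one_sub_exp_neg_pos {t : ℝ} (ht : 0 < t) : 0 < 1 - Real.exp (-t) := by
  have : Real.exp (-t) < 1 := by rw [Real.exp_lt_one_iff]; linarith
  linarith

lemma continuousOn_digammaKernel (a : ℝ) : ContinuousOn (digammaKernel a) (Ioi 0) := by
  unfold digammaKernel
  refine (ContinuousOn.div (by fun_prop) (by fun_prop) ?_).sub
    (ContinuousOn.div (by fun_prop) (by fun_prop) ?_)
  · exact fun t ht => (one_sub_exp_neg_pos ht).ne'
  · exact fun t ht => ne_of_gt ht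

lemma abs_digammaKernel_le {a t : ℝ} (ha : 0 ≤ a) (ht : 0 < t) :
    |digammaKernel a t| ≤ a + 1 := by
  have hd := one_sub_exp_neg_pos ht
  have hle : 1 - Real.exp (-t) ≤ t := by linarith [Real.add_one_le_exp (-t)]
  rw [digammaKernel, abs_le]
  constructor
  · have h1 : Real.exp (-(a * t)) / t ≤ Real.exp (-(a * t)) / (1 - Real.exp (-t)) := by gcongr
    have h2 : (1 - a * t) / t ≤ Real.exp (-(a * t)) / t := by
      gcongr
      linarith [Real.add_one_le_exp (-(a * t))]
    have h3 : (1 - a * t) / t = 1 / t - a := by field_simp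
    linarith
  · have h1 : Real.exp (-(a * t)) / (1 - Real.exp (-t)) ≤ 1 / (1 - Real.exp (-t)) := by
      gcongr
      exact Real.exp_le_one_iff.2 (by nlinarith)
    -- `1 / (1 - e^{-t}) ≤ 1 + 1 / t` amounts to `(1 + t) e^{-t} ≤ 1`
    have h2 : 1 / (1 - Real.exp (-t)) ≤ 1 + 1 / t := by
      have h3 : (t + 1) * Real.exp (-t) ≤ 1 := by
        calc (t + 1) * Real.exp (-t) ≤ Real.exp t * Real.exp (-t) := by
              gcongr
              exact Real.add_one_le_exp t
          _ = 1 := by rw [← Real.exp_add]; simp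
      rw [show 1 + 1 / t = (t + 1) / t by field_simp, div_le_div_iff₀ hd ht]
      linarith
    linarith

lemma differentiableAt_Gamma_of_pos {x : ℝ} (hx : 0 < x) : DifferentiableAt ℝ Real.Gamma x :=
  Real.differentiableOn_Gamma_Ioi.differentiableAt (Ioi_mem_nhds hx)

lemma hasDerivAt_log_Gamma {x : ℝ} (hx : 0 < x) :
    HasDerivAt (Real.log ∘ Real.Gamma) (logDeriv Real.Gamma x) x :=
  (differentiableAt_Gamma_of_pos hx).hasDerivAt.log (Real.Gamma_pos_of_pos hx).ne'

lemma log_Gamma_add_one {x : ℝ} (hx : 0 < x) :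
    Real.log (Real.Gamma (x + 1)) = Real.log (Real.Gamma x) + Real.log x := by
  rw [Real.Gamma_add_one hx.ne', Real.log_mul hx.ne' (Real.Gamma_pos_of_pos hx).ne', add_comm]

lemma logDeriv_Gamma_add_one {x : ℝ} (hx : 0 < x) :
    logDeriv Real.Gamma (x + 1) = logDeriv Real.Gamma x + 1 / x := by
  have h1 : HasDerivAt (fun y => Real.log (Real.Gamma (y + 1))) (logDeriv Real.Gamma (x + 1)) x :=
    (hasDerivAt_log_Gamma (x := x + 1) (by linarith)).comp_add_const x 1
  have h2 : HasDerivAt (fun y => Real.log (Real.Gamma y) + Real.log y)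
      (logDeriv Real.Gamma x + 1 / x) x := by
    rw [one_div]
    exact (hasDerivAt_log_Gamma hx).add (Real.hasDerivAt_log hx.ne')
  refine h1.unique (h2.congr_of_eventuallyEq ?_)
  filter_upwards [Ioi_mem_nhds hx] with y hy using log_Gamma_add_one hy

lemma logDeriv_Gamma_le_log {x : ℝ} (hx : 0 < x) : logDeriv Real.Gamma x ≤ Real.log x := by
  have h := Real.convexOn_log_Gamma.le_slope_of_hasDerivAt (mem_Ioi.2 hx)
    (mem_Ioi.2 (show 0 < x + 1 by linarith)) (by linarith) (hasDerivAt_log_Gamma hx)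
  rw [slope_def_field, Function.comp_apply, Function.comp_apply, log_Gamma_add_one hx] at h
  simpa using h

lemma log_le_logDeriv_Gamma_add_one {x : ℝ} (hx : 0 < x) :
    Real.log x ≤ logDeriv Real.Gamma (x + 1) := by
  have h := Real.convexOn_log_Gamma.slope_le_of_hasDerivAt (mem_Ioi.2 hx)
    (mem_Ioi.2 (show 0 < x + 1 by linarith)) (by linarith) (hasDerivAt_log_Gamma (by linarith))
  rw [slope_def_field, Function.comp_apply, Function.comp_apply, log_Gamma_add_one hx] at h
  simpa using h

lemma tendsto_logDeriv_Gamma_add_sub_log {a : ℝ} (ha : 0 ≤ a) :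
    Tendsto (fun y => logDeriv Real.Gamma (y + a) - Real.log y) atTop (𝓝 0) := by
  have hlog (c : ℝ) : Tendsto (fun y => Real.log (y + c) - Real.log y) atTop (𝓝 0) := by
    have h1 : Tendsto (fun y : ℝ => 1 + c * y⁻¹) atTop (𝓝 1) := by
      simpa using (tendsto_inv_atTop_zero.const_mul c).const_add 1
    have h2 := h1.log one_ne_zero
    rw [Real.log_one] at h2
    refine h2.congr' ?_
    filter_upwards [eventually_gt_atTop 0, eventually_gt_atTop (-c)] with y hy hyc
    rw [← Real.log_div (by linarith) hy.ne']
    congr 1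
    field_simp
  refine tendsto_of_tendsto_of_tendsto_of_le_of_le' (hlog (a - 1)) (hlog a) ?_ ?_
  · filter_upwards [eventually_gt_atTop 1] with y hy
    have := log_le_logDeriv_Gamma_add_one (x := y + (a - 1)) (by linarith)
    rw [show y + (a - 1) + 1 = y + a by ring] at this
    linarith
  · filter_upwards [eventually_gt_atTop 0] with y hy
    linarith [logDeriv_Gamma_le_log (x := y + a) (by linarith)]

lemma laplaceMoment_digammaKernel_sub {a y : ℝ} (ha : 0 ≤ a) (hy : 0 < y) :
    laplaceMoment (digammaKernel a) 0 y - laplaceMoment (digammaKernel a) 0 (y + 1) =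
      1 / (y + a) - Real.log ((y + 1) / y) := by
  have hint {z : ℝ} (hz : 0 < z) := integrableOn_laplaceMoment (continuousOn_digammaKernel a)
    (fun u hu => abs_digammaKernel_le ha hu) 0 hz
  have hya : 0 < y + a := by linarith
  have hy1 : 0 < y + 1 := by linarith
  have hexp := integrableOn_pow_mul_exp_neg_mul 0 hya
  have hG : IntegrableOn (fun t => t ^ 0 * Real.exp (-(y * t)) * digammaKernel a t -
      t ^ 0 * Real.exp (-((y + 1) * t)) * digammaKernel a t) (Ioi 0) :=
    (hint hy).sub (hint hy1)
  have hpt : ∀ t ∈ Ioi (0 : ℝ),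
      t ^ 0 * Real.exp (-((y + a) * t)) -
        (t ^ 0 * Real.exp (-(y * t)) * digammaKernel a t -
          t ^ 0 * Real.exp (-((y + 1) * t)) * digammaKernel a t) =
      t⁻¹ • (Real.exp (-(y * t)) - Real.exp (-((y + 1) * t))) := by
    intro t ht
    have ht : 0 < t := ht
    have hd := (one_sub_exp_neg_pos ht).ne'
    have e1 : Real.exp (-((y + a) * t)) = Real.exp (-(y * t)) * Real.exp (-(a * t)) := by
      rw [← Real.exp_add]; ring_nf
    have e2 : Real.exp (-((y + 1) * t)) = Real.exp (-(y * t)) * Real.exp (-t) := by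
      rw [← Real.exp_add]; ring_nf
    rw [e1, e2, digammaKernel, smul_eq_mul]
    field_simp
    ring
  have hfr := Frullani.integral_Ioi_eq (f := fun t : ℝ => Real.exp (-t)) (L := 1) (R := 0)
    (ContinuousOn.locallyIntegrableOn (by fun_prop) measurableSet_Ioi) hy hy1
    (by
      have : Tendsto (fun t : ℝ => Real.exp (-t)) (𝓝 0) (𝓝 (Real.exp (-0))) :=
        Continuous.tendsto (by fun_prop) 0
      simpa using this.mono_left nhdsWithin_le_nhds)
    Real.tendsto_exp_neg_atTop_nhds_zero
    ((hexp.sub hG).congr_fun hpt measurableSet_Ioi)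
  rw [← setIntegral_congr_fun measurableSet_Ioi hpt, integral_sub hexp hG,
    integral_sub (hint hy) (hint hy1), integral_pow_mul_exp_neg_mul 0 hya] at hfr
  simp only [Nat.factorial_zero, Nat.cast_one, zero_add, pow_one, sub_zero, smul_eq_mul,
    mul_one] at hfr
  unfold laplaceMoment
  linarith

/-- **Gauss's integral** with a shift: `ψ(y + a) = log y - ∫₀^∞ e^{-yt} (e^{-at}/(1-e^{-t}) - 1/t) dt`.
The difference of the two sides has period `1`, by Frullani's integral, and tends to `0` at infinity,
because `log ∘ Γ` is convex. -/
theorem logDeriv_Gamma_add_eq {a y : ℝ} (ha : 0 ≤ a) (hy : 0 < y) :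
    logDeriv Real.Gamma (y + a) = Real.log y - laplaceMoment (digammaKernel a) 0 y := by
  set D : ℝ → ℝ := fun z =>
    logDeriv Real.Gamma (z + a) - Real.log z + laplaceMoment (digammaKernel a) 0 z with hD
  have hper : ∀ z, 0 < z → D (z + 1) = D z := by
    intro z hz
    have h1 := laplaceMoment_digammaKernel_sub ha hz
    have h2 := logDeriv_Gamma_add_one (x := z + a) (by linarith)
    rw [Real.log_div (by linarith) hz.ne'] at h1
    simp only [hD]
    rw [show z + 1 + a = z + a + 1 by ring, h2]
    linarith
  have hpern : ∀ n : ℕ, D (y + n) = D y := by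
    intro n
    induction n with
    | zero => simp
    | succ n ih => rw [Nat.cast_succ, ← add_assoc, hper _ (by positivity), ih]
  have hlim : Tendsto D atTop (𝓝 0) := by
    simpa using (tendsto_logDeriv_Gamma_add_sub_log ha).add
      (tendsto_laplaceMoment_zero fun u hu => abs_digammaKernel_le ha hu)
  have hlim' : Tendsto (fun n : ℕ => D (y + n)) atTop (𝓝 0) :=
    hlim.comp (tendsto_atTop_add_const_left _ y tendsto_natCast_atTop_atTop)
  simp only [hpern] at hlim'
  have h0 : D y = 0 := tendsto_nhds_unique tendsto_const_nhds hlim'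
  simp only [hD] at h0
  linarith

/-! ### Complete monotonicity of a Laplace transform plus a logarithmic term -/

lemma IsCompletelyMonotonic.nonneg {f : ℝ → ℝ} (hf : IsCompletelyMonotonic f) {x : ℝ}
    (hx : 0 < x) : 0 ≤ f x := by
  simpa using hf.sign 0 x hx

lemma IsCompletelyMonotonic.antitoneOn {f : ℝ → ℝ} (hf : IsCompletelyMonotonic f) :
    AntitoneOn f (Ioi 0) := by
  refine antitoneOn_of_deriv_nonpos (convex_Ioi 0) hf.smooth.continuousOn ?_ ?_
  · rw [interior_Ioi]
    exact hf.smooth.differentiableOn (by simp)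
  · rw [interior_Ioi]
    intro x hx
    have := hf.sign 1 x hx
    rw [iteratedDeriv_one] at this
    linarith

/-- A completely monotonic `f` is bounded at infinity, which rules out the logarithm; then `c` is the
limit of `f` at infinity, and the density is non-negative by the uniqueness of Laplace transforms. -/
theorem isCompletelyMonotonic_iff_of_eq_laplaceMoment {f q : ℝ → ℝ} {M c κ : ℝ}
    (hq : ContinuousOn q (Ioi 0)) (hM : ∀ u, 0 < u → |q u| ≤ M)
    (hf : ∀ x, 0 < x → f x = c - κ * Real.log x + laplaceMoment q 0 x) :
    IsCompletelyMonotonic f ↔ (∀ u, 0 < u → 0 ≤ q u) ∧ κ = 0 ∧ 0 ≤ c := by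
  have hlap : Tendsto (laplaceMoment q 0) atTop (𝓝 0) := tendsto_laplaceMoment_zero hM
  have hiter (hκ : κ = 0) {n : ℕ} (hn : 0 < n) {x : ℝ} (hx : 0 < x) :
      iteratedDeriv n f x = (-1) ^ n * laplaceMoment q n x := by
    have h : f =ᶠ[𝓝 x] fun y => c + laplaceMoment q 0 y := by
      filter_upwards [Ioi_mem_nhds hx] with y hy
      rw [hf y hy, hκ]
      ring
    rw [h.iteratedDeriv_eq, iteratedDeriv_const_add hn, iteratedDeriv_laplaceMoment hq hM n hx]
  have hsign (n : ℕ) (r : ℝ) : (-1 : ℝ) ^ n * ((-1) ^ n * r) = r := by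
    rw [← mul_assoc, ← mul_pow]
    simp
  constructor
  · intro h
    have hκ : κ = 0 := by
      have hloginv : Tendsto (fun x => (Real.log x)⁻¹) atTop (𝓝 0) :=
        tendsto_inv_atTop_zero.comp Real.tendsto_log_atTop
      have h1 : Tendsto (fun x => f x * (Real.log x)⁻¹) atTop (𝓝 0) := by
        refine squeeze_zero' ?_ ?_ (by simpa using hloginv.const_mul (f 1))
        · filter_upwards [eventually_gt_atTop 1] with x hx
          exact mul_nonneg (h.nonneg (by linarith)) (inv_nonneg.2 (Real.log_pos hx).le)
        · filter_upwards [eventually_gt_atTop 1] with x hx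
          exact mul_le_mul_of_nonneg_right
            (h.antitoneOn (mem_Ioi.2 one_pos) (mem_Ioi.2 (by linarith)) hx.le)
            (inv_nonneg.2 (Real.log_pos hx).le)
      have h2 : Tendsto (fun x => (c + laplaceMoment q 0 x) * (Real.log x)⁻¹) atTop (𝓝 0) := by
        simpa using (hlap.const_add c).mul hloginv
      have h3 := h2.sub h1
      refine tendsto_nhds_unique (tendsto_const_nhds.congr' ?_) (by simpa using h3)
      filter_upwards [eventually_gt_atTop 1] with x hx
      have := (Real.log_pos hx).ne'
      rw [hf x (by linarith)]
      field_simp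
      ring
    refine ⟨fun u hu => nonneg_of_laplaceMoment_nonneg hq hM (fun n hn x hx => ?_) hu, hκ, ?_⟩
    · have := h.sign n x hx
      rwa [hiter hκ hn hx, hsign] at this
    · have h1 : Tendsto (fun x => c + laplaceMoment q 0 x) atTop (𝓝 c) := by
        simpa using hlap.const_add c
      refine ge_of_tendsto h1 ?_
      filter_upwards [eventually_gt_atTop 0] with x hx
      have := h.nonneg hx
      rw [hf x hx, hκ] at this
      linarith
  · rintro ⟨hq0, hκ, hc⟩
    have hmom (n : ℕ) (x : ℝ) : 0 ≤ laplaceMoment q n x :=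
      setIntegral_nonneg measurableSet_Ioi fun u hu =>
        mul_nonneg (mul_nonneg (pow_nonneg (le_of_lt hu) n) (Real.exp_pos _).le) (hq0 u hu)
    refine ⟨(contDiffOn_const.add (contDiffOn_laplaceMoment hq hM 0)).congr (f := fun x =>
      c + laplaceMoment q 0 x) fun x hx => ?_, fun n x hx => ?_⟩
    · rw [hf x hx, hκ]
      ring
    · rcases n.eq_zero_or_pos with rfl | hn
      · simp only [pow_zero, iteratedDeriv_zero, one_mul]
        rw [hf x hx, hκ]
        linarith [hmom 0 x]
      · rw [hiter hκ hn hx, hsign]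
        exact hmom n x

/-! ### The logarithmic derivative of the gamma ratio -/

/-- `∑ α i (e^{-a i u / A i} / (1 - e^{-u / A i}) - A i / u)`: one of the two sums in `gammaRatioQ`
with its singularity at `u = 0` removed. -/
noncomputable def sumDigammaKernel {p : ℕ} (A a α : Fin p → ℝ) (u : ℝ) : ℝ :=
  ∑ i, α i * digammaKernel (a i) (u / A i)

lemma sumDigammaKernel_add_div {p : ℕ} (A a α : Fin p → ℝ) (u : ℝ) :
    sumDigammaKernel A a α u + (∑ i, α i * A i) / u =
      ∑ i, α i * Real.exp (-(a i * u / A i)) / (1 - Real.exp (-(u / A i))) := by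
  rw [sumDigammaKernel, Finset.sum_div, ← Finset.sum_add_distrib]
  refine Finset.sum_congr rfl fun i _ => ?_
  rw [digammaKernel, one_div_div, mul_div_assoc (a i)]
  ring

lemma gammaRatioQ_eq {p s : ℕ} {A a α : Fin p → ℝ} {B b β : Fin s → ℝ}
    (h : ∑ i, α i * A i = ∑ j, β j * B j) (u : ℝ) :
    gammaRatioQ A a α B b β u = sumDigammaKernel A a α u - sumDigammaKernel B b β u := by
  rw [gammaRatioQ, ← sumDigammaKernel_add_div, ← sumDigammaKernel_add_div, h]
  ring

lemma continuousOn_sumDigammaKernel {p : ℕ} {A : Fin p → ℝ} (a α : Fin p → ℝ)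
    (hA : ∀ i, 0 < A i) : ContinuousOn (sumDigammaKernel A a α) (Ioi 0) := by
  unfold sumDigammaKernel
  refine continuousOn_finsetSum _ fun i _ => continuousOn_const.mul ?_
  exact (continuousOn_digammaKernel (a i)).comp (by fun_prop) fun u hu => div_pos hu (hA i)

lemma exists_abs_sumDigammaKernel_le {p : ℕ} {A a : Fin p → ℝ} (α : Fin p → ℝ)
    (hA : ∀ i, 0 < A i) (ha : ∀ i, 0 ≤ a i) :
    ∃ M, ∀ u, 0 < u → |sumDigammaKernel A a α u| ≤ M := by
  refine ⟨∑ i, |α i| * (a i + 1), fun u hu => (Finset.abs_sum_le_sum_abs _ _).trans ?_⟩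
  refine Finset.sum_le_sum fun i _ => ?_
  rw [abs_mul]
  gcongr
  exact abs_digammaKernel_le (ha i) (div_pos hu (hA i))

lemma laplaceMoment_comp_div (q : ℝ → ℝ) {A : ℝ} (hA : 0 < A) (x : ℝ) :
    laplaceMoment (fun u => q (u / A)) 0 x = A * laplaceMoment q 0 (A * x) := by
  have h := integral_comp_mul_left_Ioi
    (fun t => t ^ 0 * Real.exp (-(A * x * t)) * q t) 0 (inv_pos.2 hA)
  rw [mul_zero, inv_inv, smul_eq_mul] at h
  rw [laplaceMoment, laplaceMoment, ← h]
  refine integral_congr_ae (Eventually.of_forall fun u => ?_)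
  simp only [pow_zero]
  rw [show A * x * (A⁻¹ * u) = x * u by field_simp, show A⁻¹ * u = u / A by ring]

lemma laplaceMoment_sumDigammaKernel {p : ℕ} {A a : Fin p → ℝ} (α : Fin p → ℝ)
    (hA : ∀ i, 0 < A i) (ha : ∀ i, 0 ≤ a i) {x : ℝ} (hx : 0 < x) :
    laplaceMoment (sumDigammaKernel A a α) 0 x =
      ∑ i, α i * (A i * laplaceMoment (digammaKernel (a i)) 0 (A i * x)) := by
  have hint (i : Fin p) := integrableOn_laplaceMoment
    (q := fun u => digammaKernel (a i) (u / A i))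
    ((continuousOn_digammaKernel (a i)).comp (by fun_prop) fun u hu => div_pos hu (hA i))
    (fun u hu => abs_digammaKernel_le (ha i) (div_pos hu (hA i))) 0 hx
  calc laplaceMoment (sumDigammaKernel A a α) 0 x
      = ∫ u in Ioi (0 : ℝ), ∑ i, α i *
          (u ^ 0 * Real.exp (-(x * u)) * digammaKernel (a i) (u / A i)) := by
        unfold laplaceMoment sumDigammaKernel
        congr 1 with u
        rw [Finset.mul_sum]
        exact Finset.sum_congr rfl fun i _ => by ring
    _ = ∑ i, α i * laplaceMoment (fun u => digammaKernel (a i) (u / A i)) 0 x := by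
        rw [integral_finsetSum _ fun i _ => (hint i).const_mul (α i)]
        exact Finset.sum_congr rfl fun i _ => integral_const_mul _ _
    _ = _ := Finset.sum_congr rfl fun i _ => by rw [laplaceMoment_comp_div _ (hA i)]

lemma hasDerivAt_sum_log_Gamma {p : ℕ} {A a : Fin p → ℝ} (α : Fin p → ℝ)
    (hA : ∀ i, 0 < A i) (ha : ∀ i, 0 ≤ a i) {x : ℝ} (hx : 0 < x) :
    HasDerivAt (fun y => ∑ i, α i * Real.log (Real.Gamma (A i * y + a i)))
      (∑ i, α i * A i * Real.log (A i) + (∑ i, α i * A i) * Real.log x -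
        laplaceMoment (sumDigammaKernel A a α) 0 x) x := by
  have h : HasDerivAt (fun y => ∑ i, α i * Real.log (Real.Gamma (A i * y + a i)))
      (∑ i, α i * (logDeriv Real.Gamma (A i * x + a i) * A i)) x := by
    refine HasDerivAt.fun_sum fun i _ => HasDerivAt.const_mul (α i) ?_
    have hAx : 0 < A i * x := mul_pos (hA i) hx
    have hlin : HasDerivAt (fun y => A i * y + a i) (A i) x := by
      simpa using ((hasDerivAt_id x).const_mul (A i)).add_const (a i)
    exact (hasDerivAt_log_Gamma (x := A i * x + a i) (by linarith [ha i])).comp x hlin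
  refine h.congr_deriv ?_
  rw [laplaceMoment_sumDigammaKernel α hA ha hx, Finset.sum_mul, ← Finset.sum_add_distrib,
    ← Finset.sum_sub_distrib]
  refine Finset.sum_congr rfl fun i _ => ?_
  rw [logDeriv_Gamma_add_eq (ha i) (mul_pos (hA i) hx), Real.log_mul (hA i).ne' hx.ne']
  ring

lemma prod_Gamma_rpow_pos {p : ℕ} {A a : Fin p → ℝ} (α : Fin p → ℝ)
    (hA : ∀ i, 0 < A i) (ha : ∀ i, 0 ≤ a i) {x : ℝ} (hx : 0 < x) :
    0 < ∏ i, Real.Gamma (A i * x + a i) ^ α i :=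
  Finset.prod_pos fun i _ => Real.rpow_pos_of_pos
    (Real.Gamma_pos_of_pos (add_pos_of_pos_of_nonneg (mul_pos (hA i) hx) (ha i))) _

lemma log_prod_Gamma_rpow {p : ℕ} {A a : Fin p → ℝ} (α : Fin p → ℝ)
    (hA : ∀ i, 0 < A i) (ha : ∀ i, 0 ≤ a i) {x : ℝ} (hx : 0 < x) :
    Real.log (∏ i, Real.Gamma (A i * x + a i) ^ α i) =
      ∑ i, α i * Real.log (Real.Gamma (A i * x + a i)) := by
  have hpos (i : Fin p) : 0 < Real.Gamma (A i * x + a i) :=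
    Real.Gamma_pos_of_pos (add_pos_of_pos_of_nonneg (mul_pos (hA i) hx) (ha i))
  rw [Real.log_prod fun i _ => (Real.rpow_pos_of_pos (hpos i) _).ne']
  exact Finset.sum_congr rfl fun i _ => Real.log_rpow (hpos i) _

lemma gammaRatioRho_pos {p s : ℕ} {A : Fin p → ℝ} (α : Fin p → ℝ) {B : Fin s → ℝ}
    (β : Fin s → ℝ) (hA : ∀ i, 0 < A i) (hB : ∀ j, 0 < B j) : 0 < gammaRatioRho A α B β :=
  mul_pos (Finset.prod_pos fun i _ => Real.rpow_pos_of_pos (hA i) _)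
    (Finset.prod_pos fun j _ => Real.rpow_pos_of_pos (hB j) _)

lemma log_gammaRatioRho {p s : ℕ} {A : Fin p → ℝ} (α : Fin p → ℝ) {B : Fin s → ℝ}
    (β : Fin s → ℝ) (hA : ∀ i, 0 < A i) (hB : ∀ j, 0 < B j) :
    Real.log (gammaRatioRho A α B β) =
      ∑ i, α i * A i * Real.log (A i) - ∑ j, β j * B j * Real.log (B j) := by
  have hA' (i : Fin p) := (Real.rpow_pos_of_pos (hA i) (α i * A i)).ne'
  have hB' (j : Fin s) := (Real.rpow_pos_of_pos (hB j) (-(β j * B j))).ne'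
  rw [gammaRatioRho, Real.log_mul (Finset.prod_ne_zero_iff.2 fun i _ => hA' i)
    (Finset.prod_ne_zero_iff.2 fun j _ => hB' j), Real.log_prod fun i _ => hA' i,
    Real.log_prod fun j _ => hB' j, sub_eq_add_neg, ← Finset.sum_neg_distrib]
  congr 1
  · exact Finset.sum_congr rfl fun i _ => Real.log_rpow (hA i) _
  · exact Finset.sum_congr rfl fun j _ => by rw [Real.log_rpow (hB j)]; ring

lemma gammaRatio_pos {p s : ℕ} {θ : ℝ} {A a : Fin p → ℝ} (α : Fin p → ℝ) {B b : Fin s → ℝ}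
    (β : Fin s → ℝ) (hθ : 0 < θ) (hA : ∀ i, 0 < A i) (ha : ∀ i, 0 ≤ a i)
    (hB : ∀ j, 0 < B j) (hb : ∀ j, 0 ≤ b j) {x : ℝ} (hx : 0 < x) :
    0 < gammaRatio θ A a α B b β x :=
  mul_pos (Real.rpow_pos_of_pos hθ _)
    (div_pos (prod_Gamma_rpow_pos α hA ha hx) (prod_Gamma_rpow_pos β hB hb hx))

/-- Without the balance condition `∑ α i A i = ∑ β j B j`, the derivative carries a logarithmic
term. -/
theorem hasDerivAt_neg_log_gammaRatio {p s : ℕ} {θ : ℝ} {A a : Fin p → ℝ} (α : Fin p → ℝ)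
    {B b : Fin s → ℝ} (β : Fin s → ℝ) (hθ : 0 < θ) (hA : ∀ i, 0 < A i) (ha : ∀ i, 0 ≤ a i)
    (hB : ∀ j, 0 < B j) (hb : ∀ j, 0 ≤ b j) {x : ℝ} (hx : 0 < x) :
    HasDerivAt (fun y => -Real.log (gammaRatio θ A a α B b β y))
      (Real.log (θ / gammaRatioRho A α B β) -
        (∑ i, α i * A i - ∑ j, β j * B j) * Real.log x +
        laplaceMoment (fun u => sumDigammaKernel A a α u - sumDigammaKernel B b β u) 0 x) x := by
  have hV : (fun y => -Real.log (gammaRatio θ A a α B b β y)) =ᶠ[𝓝 x] fun y =>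
      y * Real.log θ - ∑ i, α i * Real.log (Real.Gamma (A i * y + a i)) +
        ∑ j, β j * Real.log (Real.Gamma (B j * y + b j)) := by
    filter_upwards [Ioi_mem_nhds hx] with y hy
    have hP := prod_Gamma_rpow_pos α hA ha hy
    have hS := prod_Gamma_rpow_pos β hB hb hy
    rw [gammaRatio, Real.log_mul (Real.rpow_pos_of_pos hθ _).ne' (div_pos hP hS).ne',
      Real.log_div hP.ne' hS.ne', Real.log_rpow hθ, log_prod_Gamma_rpow α hA ha hy,
      log_prod_Gamma_rpow β hB hb hy]
    ring
  have hlap : laplaceMoment (fun u => sumDigammaKernel A a α u - sumDigammaKernel B b β u) 0 x =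
      laplaceMoment (sumDigammaKernel A a α) 0 x - laplaceMoment (sumDigammaKernel B b β) 0 x := by
    obtain ⟨M, hM⟩ := exists_abs_sumDigammaKernel_le α hA ha
    obtain ⟨N, hN⟩ := exists_abs_sumDigammaKernel_le β hB hb
    simp only [laplaceMoment, mul_sub]
    exact integral_sub
      (integrableOn_laplaceMoment (continuousOn_sumDigammaKernel a α hA) hM 0 hx)
      (integrableOn_laplaceMoment (continuousOn_sumDigammaKernel b β hB) hN 0 hx)
  have h := (((hasDerivAt_id x).mul_const (Real.log θ)).sub
    (hasDerivAt_sum_log_Gamma α hA ha hx)).add (hasDerivAt_sum_log_Gamma β hB hb hx)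
  refine (h.congr_of_eventuallyEq hV).congr_deriv ?_
  rw [hlap, Real.log_div hθ.ne' (gammaRatioRho_pos α β hA hB).ne', log_gammaRatioRho α β hA hB]
  ring

/-- Smoothness of a positive `f` need not be checked separately: it follows from that of
`(-log f)'`. -/
lemma isLogCompletelyMonotonic_iff {f : ℝ → ℝ} (hpos : ∀ x, 0 < x → 0 < f x)
    (hdiff : DifferentiableOn ℝ (fun x => -Real.log (f x)) (Ioi 0)) :
    IsLogCompletelyMonotonic f ↔ IsCompletelyMonotonic (deriv fun x => -Real.log (f x)) := by
  refine ⟨fun h => h.neg_log_deriv, fun h => ⟨hpos, ?_, h⟩⟩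
  have hlog : ContDiffOn ℝ ∞ (fun x => -Real.log (f x)) (Ioi 0) :=
    (contDiffOn_infty_iff_deriv_of_isOpen isOpen_Ioi).2 ⟨hdiff, h.smooth⟩
  refine hlog.neg.exp.congr fun x hx => ?_
  rw [neg_neg, Real.exp_log (hpos x hx)]

theorem mainTheorem4 {p s : ℕ} (θ : ℝ) (A a α : Fin p → ℝ) (B b β : Fin s → ℝ)
    (hθ : 0 < θ) (hA : ∀ i, 0 < A i) (ha : ∀ i, 0 ≤ a i) (hα : ∀ i, 0 < α i)
    (hB : ∀ j, 0 < B j) (hb : ∀ j, 0 ≤ b j) (hβ : ∀ j, 0 < β j) :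
    (IsLogCompletelyMonotonic (gammaRatio θ A a α B b β) ↔
      (∀ u : ℝ, 0 < u → 0 ≤ gammaRatioQ A a α B b β u) ∧
      ∑ i, α i * A i = ∑ j, β j * B j ∧
      gammaRatioRho A α B β ≤ θ) ∧
    (IsLogCompletelyMonotonic (gammaRatio θ A a α B b β) →
      ∀ x : ℝ, 0 < x →
        MeasureTheory.IntegrableOn
          (fun u : ℝ => Real.exp (-(x * u)) * gammaRatioQ A a α B b β u) (Set.Ioi 0) ∧
        HasDerivAt (fun y : ℝ => -Real.log (gammaRatio θ A a α B b β y))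
          ((∫ u in Set.Ioi (0 : ℝ), Real.exp (-(x * u)) * gammaRatioQ A a α B b β u) +
            Real.log (θ / gammaRatioRho A α B β)) x) := by
  have hderiv {x : ℝ} (hx : 0 < x) := hasDerivAt_neg_log_gammaRatio α β hθ hA ha hB hb hx
  have hcont : ContinuousOn (fun u => sumDigammaKernel A a α u - sumDigammaKernel B b β u)
      (Ioi 0) :=
    (continuousOn_sumDigammaKernel a α hA).sub (continuousOn_sumDigammaKernel b β hB)
  obtain ⟨M, hM⟩ := exists_abs_sumDigammaKernel_le α hA ha
  obtain ⟨N, hN⟩ := exists_abs_sumDigammaKernel_le β hB hb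
  have hbdd : ∀ u, 0 < u → |sumDigammaKernel A a α u - sumDigammaKernel B b β u| ≤ M + N :=
    fun u hu => (abs_sub _ _).trans (add_le_add (hM u hu) (hN u hu))
  have hρ : 0 ≤ Real.log (θ / gammaRatioRho A α B β) ↔ gammaRatioRho A α B β ≤ θ := by
    have hρ0 := gammaRatioRho_pos α β hA hB
    rw [Real.log_nonneg_iff (div_pos hθ hρ0), one_le_div hρ0]
  have hiff : IsLogCompletelyMonotonic (gammaRatio θ A a α B b β) ↔
      (∀ u : ℝ, 0 < u → 0 ≤ gammaRatioQ A a α B b β u) ∧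
      ∑ i, α i * A i = ∑ j, β j * B j ∧ gammaRatioRho A α B β ≤ θ := by
    rw [isLogCompletelyMonotonic_iff (fun x hx => gammaRatio_pos α β hθ hA ha hB hb hx)
        (fun x hx => (hderiv hx).differentiableAt.differentiableWithinAt),
      isCompletelyMonotonic_iff_of_eq_laplaceMoment hcont hbdd (fun x hx => (hderiv hx).deriv),
      sub_eq_zero, hρ]
    -- under the balance condition the bounded density is `Q` itself
    refine and_congr_left fun h => ?_
    simp only [gammaRatioQ_eq h.1]
  refine ⟨hiff, fun h x hx => ?_⟩
  have hbal := (hiff.1 h).2.1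
  have hint := integrableOn_laplaceMoment hcont hbdd 0 hx
  have hd := hderiv hx
  simp only [hbal, sub_self, zero_mul, sub_zero, laplaceMoment, pow_zero, one_mul] at hd hint
  simp only [gammaRatioQ_eq hbal]
  exact ⟨hint, hd.congr_deriv (add_comm _ _)⟩
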